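/- Let $p$ be a prime and let $\mathcal{O}$ be a complete discrete valuation ring whose residue field has characteristic $p$ and whose field of fractions $K$ has characteristic $0$. Let $P$ be a finite $p$-group having a normal cyclic subgroup of index $p$, and assume that $K$ is a splitting field for $P$, that is, $\mathrm{End}_{KP}(V)=K$ for every simple $KP$-module $V$. Denote by $\mathrm{Irr}_K(P)$ the set of characters of the simple $KP$-modules and, for $\chi\in\mathrm{Irr}_K(P)$, put $e(\chi)=\frac{\chi(1)}{|P|}\sum_{x\in P}\chi(x^{-1})\,x$, the primitive idempotent of $Z(KP)$ corresponding to $\chi$. Then for every $\chi\in\mathrm{Irr}_K(P)$ the $\mathcal{O}$-algebra $\mathcal{O}P\,e(\chi)=\{a\,e(\chi)\mid a\in\mathcal{O}P\}\subseteq KP$, with unit element $e(\chi)$, is symmetric; that is, $A=\mathcal{O}P\,e(\chi)$ is finitely generated projective as an $\mathcal{O}$-module and $A\cong\mathrm{Hom}_{\mathcal{O}}(A,\mathcal{O})$ as $A$-$A$-bimodules. -/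

import Mathlib

open scoped MonoidAlgebra

noncomputable section

/-- `A` is a symmetric `O`-algebra: it is finitely generated projective as an `O`-module, and it
is isomorphic to its dual `Hom_O(A, O)` as an `A`-`A`-bimodule, where the bimodule structure on
the dual is `(a · f · b) y = f (b * y * a)`. -/
structure IsSymmetricAlg (O A : Type*) [CommRing O] [Ring A] [Algebra O A] : Prop where
  finite : Module.Finite O A
  projective : Module.Projective O A
  exists_bimodule_equiv : ∃ φ : A ≃ₗ[O] Module.Dual O A,
    ∀ a b x y : A, φ (a * x * b) y = φ x (b * y * a)

/-- The set `Irr_K(G)` of characters of the simple `K[G]`-modules. Every simple module is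
finite-dimensional, hence isomorphic to one with underlying space `K ^ n`. -/
def IrrChar (K G : Type*) [Field K] [Group G] : Set (G → K) :=
  {χ | ∃ (n : ℕ) (ρ : Representation K G (Fin n → K)), ρ.IsIrreducible ∧ ρ.character = χ}

/-- `K` is a splitting field for the finite group `G`: every endomorphism of a simple
`K[G]`-module is a scalar. -/
def IsSplittingFieldFor (K G : Type*) [Field K] [Group G] : Prop :=
  ∀ (n : ℕ) (ρ : Representation K G (Fin n → K)), ρ.IsIrreducible →
    Function.Surjective (algebraMap K (ρ.IntertwiningMap ρ))

section Idempotent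

variable {K G : Type*} [Field K] [Group G] [Fintype G]

/-- The element `e(χ) = (χ(1) / |G|) ∑ x, χ(x⁻¹) x` of `K[G]`. -/
def charIdem (χ : G → K) : K[G] :=
  ∑ x : G, MonoidAlgebra.single x (χ 1 / (Nat.card G : K) * χ x⁻¹)

theorem charIdem_commute {χ : G → K} (hχ : χ ∈ IrrChar K G) (a : K[G]) :
    Commute (charIdem χ) a := by
  obtain ⟨n, ρ, -, rfl⟩ := hχ
  induction a using MonoidAlgebra.induction_linear with
  | zero => exact Commute.zero_right _
  | add f g hf hg => exact hf.add_right hg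
  | single g r =>
    unfold Commute SemiconjBy charIdem
    rw [Finset.sum_mul, Finset.mul_sum]
    refine Fintype.sum_equiv (MulAut.conj g⁻¹).toEquiv _ _ fun x => ?_
    have h : ρ.character (g⁻¹ * (x⁻¹ * g)) = ρ.character x⁻¹ := by
      simpa [mul_assoc] using ρ.char_conj x⁻¹ g⁻¹
    simp [MonoidAlgebra.single_mul_single, h, mul_comm, mul_assoc]

/-- On a simple module with character `ψ`, the element `e(χ)` acts as the identity if `ψ = χ`,
and as zero otherwise. -/
theorem charIdem_act [CharZero K] (hK : IsSplittingFieldFor K G) {χ : G → K}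
    (hχ : χ ∈ IrrChar K G) {m : ℕ} (σ : Representation K G (Fin m → K))
    (hσ : σ.IsIrreducible) :
    (σ.character = χ → σ.asAlgebraHom (charIdem χ) = 1) ∧
      (σ.character ≠ χ → σ.asAlgebraHom (charIdem χ) = 0) := by
  have hcomm := charIdem_commute hχ
  obtain ⟨n, ρ, hρ, rfl⟩ := hχ
  have hcard : (Nat.card G : K) ≠ 0 := by
    exact_mod_cast Nat.card_pos.ne'
  let _ : Invertible (Nat.card G : K) := invertibleOfNonzero hcard
  have hm : (m : K) ≠ 0 := by
    rintro h0
    obtain rfl : m = 0 := by exact_mod_cast h0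
    obtain ⟨U, V, hUV⟩ := hσ.toNontrivial
    apply hUV
    ext v
    rw [Subsingleton.elim v 0]
    exact ⟨fun _ => V.toSubmodule.zero_mem, fun _ => U.toSubmodule.zero_mem⟩
  obtain ⟨c, hc⟩ := hK m σ hσ
    ⟨σ.asAlgebraHom (charIdem ρ.character), fun g => by
      have := congrArg σ.asAlgebraHom (hcomm (MonoidAlgebra.single g 1))
      rw [map_mul, map_mul, Representation.asAlgebraHom_single_one] at this
      exact this⟩
  have hc' : σ.asAlgebraHom (charIdem ρ.character) = c • 1 :=
    (congrArg Representation.IntertwiningMap.toLinearMap hc).symm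
  have htr : c * (m : K) = ρ.character 1 *
      (Module.finrank K (ρ.IntertwiningMap σ) : K) := by
    have h1 := congrArg (LinearMap.trace K _) hc'
    rw [map_smul, LinearMap.trace_one, Module.finrank_fin_fun, smul_eq_mul] at h1
    rw [← Representation.card_inv_mul_sum_char_mul_char_eq_finrank, ← h1, charIdem, map_sum,
      map_sum, Finset.mul_sum, Finset.mul_sum]
    refine Finset.sum_congr rfl fun x _ => ?_
    rw [Representation.asAlgebraHom_single, map_smul, smul_eq_mul]
    change _ * σ.character x = _
    ring
  rw [hc']
  refine ⟨fun h => ?_, fun h => ?_⟩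
  · have hfr : (Module.finrank K (ρ.IntertwiningMap σ) : K) = 1 := by
      rw [← Representation.card_inv_mul_sum_char_mul_char_eq_finrank, ← h,
        Representation.card_inv_mul_sum_char_mul_char_eq_finrank]
      have hinj : Function.Injective (algebraMap K (σ.IntertwiningMap σ)) := by
        intro a b hab
        have h2 : a • (1 : Module.End K (Fin m → K)) = b • 1 :=
          congrArg Representation.IntertwiningMap.toLinearMap hab
        have h3 := congrArg (LinearMap.trace K _) h2
        simpa [hm] using h3
      rw [← (LinearEquiv.ofBijective (Algebra.linearMap K (σ.IntertwiningMap σ))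
        ⟨hinj, hK m σ hσ⟩).finrank_eq]
      simp
    rw [hfr, ← h, Representation.char_one, Module.finrank_fin_fun, mul_one] at htr
    rw [mul_right_cancel₀ hm (htr.trans (one_mul _).symm), one_smul]
  · have : IsEmpty (ρ.Equiv σ) := ⟨fun φ => h (Representation.char_iso φ).symm⟩
    have h0 : Module.finrank K (ρ.IntertwiningMap σ) = 0 :=
      Module.finrank_zero_of_subsingleton
    rw [h0, Nat.cast_zero, mul_zero] at htr
    rw [(mul_eq_zero.mp htr).resolve_right hm, zero_smul]

/-- An element of `K[G]` that acts as zero on all simple modules is zero. -/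
theorem eq_zero_of_forall_act [CharZero K] (x : K[G])
    (hx : ∀ (m : ℕ) (σ : Representation K G (Fin m → K)), σ.IsIrreducible →
      σ.asAlgebraHom x = 0) : x = 0 := by
  have hne : NeZero (Nat.card G : K) := ⟨by exact_mod_cast Nat.card_pos.ne'⟩
  have key : ∀ S : Submodule K[G] K[G], IsSimpleModule K[G] S → ∀ s ∈ S, x * s = 0 := by
    intro S hS s hs
    have : Module.Finite K S :=
      Module.Finite.of_injective (S.subtype.restrictScalars K) S.subtype_injective
    let f : S ≃ₗ[K] (Fin (Module.finrank K S) → K) := (Module.finBasis K S).equivFun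
    let σ : Representation K G (Fin (Module.finrank K S) → K) :=
      ((f.conjAlgEquiv K : _ →* _)).comp (Representation.ofModule' (k := K) (G := G) S)
    have hσ : ∀ (y : K[G]) (t : S), σ.asAlgebraHom y (f t) = f (y • t) := by
      intro y t
      induction y using MonoidAlgebra.induction_linear with
      | zero => simp
      | add a b ha hb => simp [ha, hb, add_smul]
      | single g r =>
        have h1 : r • MonoidAlgebra.single g (1 : K) = MonoidAlgebra.single g r := by simp
        simp [σ, Representation.ofModule', ← map_smul, h1]
    let F : S ≃ₗ[K[G]] σ.asModule :=
      { f with map_smul' := fun y t => (hσ y t).symm }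
    have hirr : σ.IsIrreducible := by
      rw [Representation.irreducible_iff_isSimpleModule_asModule]
      exact IsSimpleModule.congr F.symm
    have h1 := hσ x ⟨s, hs⟩
    rw [hx _ σ hirr, LinearMap.zero_apply, eq_comm, f.map_eq_zero_iff] at h1
    exact congrArg Subtype.val h1
  have htop := IsSemisimpleModule.sSup_simples_eq_top K[G] K[G]
  have h1 : (1 : K[G]) ∈ sSup {m : Submodule K[G] K[G] | IsSimpleModule K[G] m} := by
    rw [htop]; trivial
  rw [sSup_eq_iSup'] at h1
  rw [← mul_one x]
  refine Submodule.iSup_induction _ (motive := fun y => x * y = 0) h1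
    (fun S s hs => key S.1 S.2 s hs) (mul_zero x) fun a b ha hb => ?_
  rw [mul_add, ha, hb, add_zero]

theorem isIdempotentElem_charIdem [CharZero K] (hK : IsSplittingFieldFor K G) {χ : G → K}
    (hχ : χ ∈ IrrChar K G) : IsIdempotentElem (charIdem χ) := by
  rw [IsIdempotentElem, ← sub_eq_zero]
  refine eq_zero_of_forall_act _ fun m σ hσ => ?_
  obtain ⟨h1, h0⟩ := charIdem_act hK hχ σ hσ
  by_cases h : σ.character = χ
  · simp [h1 h]
  · simp [h0 h]

end Idempotent

/-- For an idempotent `e` of an `O`-algebra `B`, the ring `e B e` with unit element `e` is an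
`O`-algebra, by scalar multiplication in `B`. -/
instance cornerAlgebra {O B : Type*} [CommRing O] [Ring B] [Algebra O B] {e : B}
    (he : IsIdempotentElem e) : Algebra O he.Corner where
  smul r c := ⟨r • c.1, by
    obtain ⟨b, hb⟩ := c.2
    exact ⟨r • b, by simp only [← hb, mul_smul_comm, smul_mul_assoc]⟩⟩
  algebraMap :=
    { toFun := fun r => ⟨r • e, ⟨r • e, by
        simp only [mul_smul_comm, smul_mul_assoc, he.eq]⟩⟩
      map_one' := Subtype.ext (one_smul O e)
      map_mul' := fun r s => Subtype.ext (by
        change (r * s) • e = (r • e) * (s • e)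
        rw [smul_mul_smul_comm, he.eq])
      map_zero' := Subtype.ext (zero_smul O e)
      map_add' := fun r s => Subtype.ext (add_smul r s e) }
  commutes' := fun r c => Subtype.ext (by
    obtain ⟨h1, h2⟩ := (Subsemigroup.mem_corner_iff he).mp c.2
    change (r • e) * c.1 = c.1 * (r • e)
    rw [smul_mul_assoc, mul_smul_comm, h1, h2])
  smul_def' := fun r c => Subtype.ext (by
    obtain ⟨h1, -⟩ := (Subsemigroup.mem_corner_iff he).mp c.2
    change r • c.1 = (r • e) * c.1
    rw [smul_mul_assoc, h1])

section Quotient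

variable (O : Type*) {K G : Type*} [CommRing O] [Field K] [CharZero K] [Algebra O K] [Group G]
  [Fintype G]

/-- The `O`-algebra `O[G] e(χ)`: the set of all products `a * e(χ)` in `K[G]` with `a` in the
image of `O[G]`, with the operations of `K[G]` and with unit element `e(χ)`. -/
def charQuotient (hK : IsSplittingFieldFor K G) {χ : G → K} (hχ : χ ∈ IrrChar K G) :
    Subalgebra O (isIdempotentElem_charIdem hK hχ).Corner where
  carrier := {c | ∃ a : O[G],
    c.1 = MonoidAlgebra.mapRingHom G (algebraMap O K) a * charIdem χ}
  mul_mem' := by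
    rintro c d ⟨a, ha⟩ ⟨b, hb⟩
    refine ⟨a * b, ?_⟩
    change c.1 * d.1 = _
    rw [ha, hb, map_mul, mul_assoc, ← mul_assoc (charIdem χ), (charIdem_commute hχ _).eq,
      mul_assoc, (isIdempotentElem_charIdem hK hχ).eq, mul_assoc]
  add_mem' := by
    rintro c d ⟨a, ha⟩ ⟨b, hb⟩
    refine ⟨a + b, ?_⟩
    change c.1 + d.1 = _
    rw [ha, hb, map_add, add_mul]
  algebraMap_mem' := by
    intro r
    refine ⟨MonoidAlgebra.single 1 r, ?_⟩
    change r • charIdem χ = _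
    rw [MonoidAlgebra.mapRingHom_single, ← algebraMap_smul K r (charIdem χ), Algebra.smul_def]
    rfl

end Quotient

end

/-! Let `ρ` afford `χ`. It sends `e(χ)` to `1`, and whatever it kills is annihilated by `e(χ)`, so
`O[P] e(χ)` is isomorphic to the `O`-span of `ρ(P)` (`charQuotient_isSymmetricAlg_of_image`).
Symmetry of that span follows from a trace form, `O`-valued on it, together with a spanning family
and a dual family (`Subalgebra.isSymmetricAlg_of_dual_families`).

Let `h` generate the cyclic subgroup, let `t` lie outside it, `t h t⁻¹ = h ^ u`, and let `p ^ m` be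
the order of `ρ h`. Since `t ^ p` is a power of `h`, `u ^ p ≡ 1` modulo `p ^ m`, which leaves two
cases (`Int.prime_pow_dvd_sub_one_sq_or`).

If `p ^ m ∣ (u - 1) ^ 2`, commutators act as scalars. The normalized trace vanishes on group
elements that are not scalar, so representatives of the cosets of the scalar subgroup are dual to
their inverses (`Representation.isSymmetricAlg_image_of_commutator`).

Otherwise `p = 2`, `m ≥ 3` and `u ≡ -1` modulo `2 ^ (m - 1)`. Then `X = ρ h` and `T = ρ t` satisfy
`T X T⁻¹ = ε X⁻¹` with `ε = ±1`, and `X + ε X⁻¹` is a scalar `α`. Nested square roots, as for `2 cos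
(π / 2 ^ j)`, give `α c = 2` with `α` and `c` both nonunits of `O`. The normalized trace of `X` is
`α / 2`, so `c` times that trace takes the values `c` at `1` and `1` at `X`; its Gram matrix on `1,
X` is invertible over `O`. The part `T O[X]` is orthogonal to `O[X]` because `X ^ 2 ^ (m - 2)`
anticommutes with `T` (`Subalgebra.isSymmetricAlg_of_conj_eq_inv`). -/

/-! ### Symmetric algebras from dual families -/

theorem IsSymmetricAlg.of_dual_families {O A ι : Type*} [CommRing O] [Ring A] [Algebra O A]
    [Fintype ι] [DecidableEq ι] (s : A →ₗ[O] O) (hs : ∀ x y, s (x * y) = s (y * x))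
    (b c : ι → A) (hspan : ∀ x, x ∈ Submodule.span O (Set.range b))
    (hdual : ∀ i j, s (b i * c j) = if i = j then 1 else 0) : IsSymmetricAlg O A := by
  -- Expansion in dual families: `s (x * c i)` is the `i`-th coordinate, so `x` is determined by the
  -- functional `y ↦ s (x * y)`.
  have key : ∀ x, ∑ i, s (x * c i) • b i = x := by
    intro x
    induction hspan x using Submodule.span_induction with
    | mem x hx =>
      obtain ⟨j, rfl⟩ := hx
      simp [hdual]
    | zero => simp
    | add x y _ _ hx hy => simp [add_mul, add_smul, Finset.sum_add_distrib, hx, hy]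
    | smul r x _ hx => simp [mul_smul, ← Finset.smul_sum, hx]
  have hli : LinearIndependent O b := by
    rw [Fintype.linearIndependent_iff]
    intro g hg j
    simpa [Finset.sum_mul, hdual] using congrArg (fun x => s (x * c j)) hg
  let B : Module.Basis ι O A := Module.Basis.mk hli fun x _ => hspan x
  let φ : A →ₗ[O] Module.Dual O A := (LinearMap.mul O A).compr₂ s
  have hφ : ∀ x y, φ x y = s (x * y) := fun x y => rfl
  have hbij : Function.Bijective φ := by
    constructor
    · rw [← LinearMap.ker_eq_bot, LinearMap.ker_eq_bot']
      intro x hx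
      rw [← key x]
      refine Finset.sum_eq_zero fun i _ => ?_
      rw [← hφ, hx]
      simp
    · intro f
      refine ⟨∑ j, f (b j) • c j, B.ext fun i => ?_⟩
      simp [hφ, B, hs (c _), hdual]
  exact
    { finite := Module.Finite.of_basis B
      projective := Module.Projective.of_basis B
      exists_bimodule_equiv := ⟨LinearEquiv.ofBijective φ hbij, fun a d x y => by
        simp only [LinearEquiv.ofBijective_apply, hφ]
        rw [mul_assoc, mul_assoc, hs]
        simp only [mul_assoc]⟩ }

theorem IsSymmetricAlg.congr {O A B : Type*} [CommRing O] [Ring A] [Algebra O A] [Ring B]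
    [Algebra O B] (f : A ≃ₐ[O] B) (hA : IsSymmetricAlg O A) : IsSymmetricAlg O B := by
  obtain ⟨h1, h2, φ, hφ⟩ := hA
  refine ⟨Module.Finite.equiv f.toLinearEquiv, Module.Projective.of_equiv f.toLinearEquiv,
    f.symm.toLinearEquiv.trans (φ.trans f.symm.toLinearEquiv.dualMap), fun a b x y => ?_⟩
  simp [hφ]

/-- A subalgebra of a `K`-algebra is symmetric if some trace form of the `K`-algebra takes
values in `O` on it and admits a spanning family with a dual family. -/
theorem Subalgebra.isSymmetricAlg_of_dual_families {O K E ι : Type*} [CommRing O] [Field K]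
    [Algebra O K] [FaithfulSMul O K] [Ring E] [Algebra K E] [Algebra O E] [IsScalarTower O K E]
    [Fintype ι] [DecidableEq ι] (S : Subalgebra O E) (τ : E →ₗ[K] K)
    (hτ : ∀ x y, τ (x * y) = τ (y * x)) (b c : ι → E) (hb : ∀ i, b i ∈ S) (hc : ∀ i, c i ∈ S)
    (hspan : ∀ x ∈ S, x ∈ Submodule.span O (Set.range b))
    (hint : ∀ i, ∃ r : O, algebraMap O K r = τ (b i))
    (hdual : ∀ i j, τ (b i * c j) = if i = j then 1 else 0) : IsSymmetricAlg O S := by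
  have hinj := FaithfulSMul.algebraMap_injective O K
  have hsmul : ∀ (r : O) (x : E), τ (r • x) = algebraMap O K r * τ x := by
    intro r x
    rw [← algebraMap_smul K r x, map_smul, smul_eq_mul]
  have hall : ∀ x : S, ∃ r : O, algebraMap O K r = τ x := by
    rintro ⟨x, hx⟩
    refine Submodule.span_induction (p := fun x _ => ∃ r : O, algebraMap O K r = τ x)
      ?_ ⟨0, by simp⟩ ?_ ?_ (hspan x hx)
    · rintro _ ⟨j, rfl⟩
      exact hint j
    · rintro x y - - ⟨r, hr⟩ ⟨r', hr'⟩
      exact ⟨r + r', by simp [hr, hr']⟩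
    · rintro r x - ⟨r', hr'⟩
      exact ⟨r * r', by rw [hsmul, map_mul, hr']⟩
  choose s hs using hall
  let s' : S →ₗ[O] O :=
    { toFun := s
      map_add' := fun x y => hinj (by simp [hs])
      map_smul' := fun r x => hinj (by simp [hs, hsmul]) }
  have hs' : ∀ x : S, algebraMap O K (s' x) = τ x := hs
  refine IsSymmetricAlg.of_dual_families s' (fun x y => hinj ?_) (fun i => ⟨b i, hb i⟩)
    (fun i => ⟨c i, hc i⟩) (fun x => ?_) (fun i j => hinj ?_)
  · rw [hs', hs']
    exact hτ _ _
  · have h1 := hspan x x.2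
    have h2 : Submodule.span O (Set.range b) =
        (Submodule.span O (Set.range fun i => (⟨b i, hb i⟩ : S))).map S.val.toLinearMap := by
      rw [Submodule.map_span, ← Set.range_comp]
      rfl
    rw [h2] at h1
    obtain ⟨y, hy, hyx⟩ := h1
    rwa [← Subtype.ext hyx]
  · rw [hs']
    refine (hdual i j).trans ?_
    split_ifs <;> simp

/-! ### From `O[G] e(χ)` to the image of `O[G]` -/

section Image
variable {K G : Type*} [Field K] [Group G]

/-- The `O`-span of the image of `G` under a representation, as a subalgebra. -/
noncomputable def Representation.imageSubalgebra (O : Type*) [CommRing O] [Algebra O K] {n : ℕ}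
    (ρ : Representation K G (Fin n → K)) : Subalgebra O (Module.End K (Fin n → K)) :=
  (MonoidAlgebra.lift O (Module.End K (Fin n → K)) G ρ).range

variable {O : Type*} [CommRing O] [Algebra O K] {n : ℕ} (ρ : Representation K G (Fin n → K))

theorem Representation.apply_mem_imageSubalgebra (g : G) : ρ g ∈ ρ.imageSubalgebra O :=
  ⟨MonoidAlgebra.single g 1, by simp⟩

theorem Representation.mem_span_of_mem_imageSubalgebra {x : Module.End K (Fin n → K)}
    (hx : x ∈ ρ.imageSubalgebra O) {N : Submodule O (Module.End K (Fin n → K))}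
    (hN : ∀ g, ρ g ∈ N) : x ∈ N := by
  obtain ⟨a, rfl⟩ := hx
  change MonoidAlgebra.lift O (Module.End K (Fin n → K)) G ρ a ∈ N
  induction a using MonoidAlgebra.induction_linear with
  | zero => simp
  | add f g hf hg => rw [map_add]; exact N.add_mem hf hg
  | single g r =>
    rw [MonoidAlgebra.lift_single]
    exact N.smul_mem _ (hN g)

theorem Representation.asAlgebraHom_mapRingHom (a : O[G]) :
    ρ.asAlgebraHom (MonoidAlgebra.mapRingHom G (algebraMap O K) a) =
      MonoidAlgebra.lift O (Module.End K (Fin n → K)) G ρ a := by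
  induction a using MonoidAlgebra.induction_linear with
  | zero => simp
  | add f g hf hg => simp only [map_add, hf, hg]
  | single g r =>
    simp [MonoidAlgebra.mapRingHom_single, Representation.asAlgebraHom_single]

theorem Representation.exists_eq_smul_one_of_commute (hK : IsSplittingFieldFor K G)
    (hρ : ρ.IsIrreducible) {x : Module.End K (Fin n → K)} (hx : ∀ g, Commute x (ρ g)) :
    ∃ k : K, x = k • 1 := by
  obtain ⟨c, hc⟩ := hK n ρ hρ ⟨x, fun g => hx g⟩
  exact ⟨c, (congrArg Representation.IntertwiningMap.toLinearMap hc).symm⟩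

theorem Representation.IsIrreducible.dim_ne_zero {ρ : Representation K G (Fin n → K)}
    (hρ : ρ.IsIrreducible) : n ≠ 0 := by
  rintro rfl
  obtain ⟨U, V, hUV⟩ := hρ.toNontrivial
  apply hUV
  ext v
  rw [Subsingleton.elim v 0]
  exact ⟨fun _ => V.toSubmodule.zero_mem, fun _ => U.toSubmodule.zero_mem⟩

variable [Fintype G] [CharZero K]

/-- Irreducible representations with the same character are isomorphic; hence an element of the
group algebra killed by one of them is killed by the other. -/
theorem Representation.asAlgebraHom_eq_zero_of_character_eq {m : ℕ}
    {ρ : Representation K G (Fin n → K)} {σ : Representation K G (Fin m → K)}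
    (hρ : ρ.IsIrreducible) (hσ : σ.IsIrreducible) (h : σ.character = ρ.character) {x : K[G]}
    (hx : ρ.asAlgebraHom x = 0) : σ.asAlgebraHom x = 0 := by
  let _ : Invertible (Nat.card G : K) := invertibleOfNonzero (by exact_mod_cast Nat.card_pos.ne')
  -- Both dimensions are the inner product of the characters; the right one is nonzero, which forces
  -- an isomorphism.
  have hne : (Module.finrank K (ρ.IntertwiningMap σ) : K) =
      Module.finrank K (ρ.IntertwiningMap ρ) := by
    rw [← Representation.card_inv_mul_sum_char_mul_char_eq_finrank, h,
      Representation.card_inv_mul_sum_char_mul_char_eq_finrank]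
  by_cases hiso : IsEmpty (ρ.Equiv σ)
  · have h0 : Module.finrank K (ρ.IntertwiningMap σ) = 0 :=
      Module.finrank_zero_of_subsingleton
    rw [h0, Nat.cast_zero, eq_comm, Nat.cast_eq_zero] at hne
    have : Nontrivial (ρ.IntertwiningMap ρ) := by
      refine ⟨⟨1, 0, fun h10 => ?_⟩⟩
      have h1 : (1 : Module.End K (Fin n → K)) = 0 :=
        congrArg Representation.IntertwiningMap.toLinearMap h10
      have h2 := congrArg (LinearMap.trace K _) h1
      rw [LinearMap.trace_one, Module.finrank_fin_fun, map_zero, Nat.cast_eq_zero] at h2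
      exact hρ.dim_ne_zero h2
    exact absurd hne Module.finrank_pos.ne'
  · obtain ⟨φ⟩ := not_isEmpty_iff.mp hiso
    have hφ : ∀ (y : K[G]) (v : Fin n → K),
        σ.asAlgebraHom y (φ v) = φ (ρ.asAlgebraHom y v) := by
      intro y v
      induction y using MonoidAlgebra.induction_linear with
      | zero => simp
      | add f g hf hg => simp [hf, hg]
      | single g r =>
        have h1 : σ g (φ v) = φ (ρ g v) := 
          (Representation.IntertwiningMap.isIntertwining ρ σ φ.toIntertwiningMap g v).symm
        simp [Representation.asAlgebraHom_single, h1]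
    refine LinearMap.ext fun w => ?_
    rw [← φ.apply_symm_apply w, hφ, hx]
    simp

/-- On each simple module one of the two factors acts as zero: `x` if the character is `χ`, the
idempotent otherwise. This makes `ρ` injective on `O[G] e(χ)`. -/
theorem charIdem_mul_eq_zero (hK : IsSplittingFieldFor K G) {χ : G → K} (hχ : χ ∈ IrrChar K G)
    (hρ : ρ.IsIrreducible) (hρχ : ρ.character = χ) {x : K[G]} (hx : ρ.asAlgebraHom x = 0) :
    x * charIdem χ = 0 := by
  refine eq_zero_of_forall_act _ fun m σ hσ => ?_
  rw [map_mul]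
  by_cases h : σ.character = χ
  · rw [Representation.asAlgebraHom_eq_zero_of_character_eq hρ hσ (h.trans hρχ.symm) hx, zero_mul]
  · rw [(charIdem_act hK hχ σ hσ).2 h, mul_zero]

theorem charQuotient_isSymmetricAlg_of_image (hK : IsSplittingFieldFor K G) {χ : G → K}
    (hχ : χ ∈ IrrChar K G) (hρ : ρ.IsIrreducible) (hρχ : ρ.character = χ)
    (h : IsSymmetricAlg O (ρ.imageSubalgebra O)) : IsSymmetricAlg O (charQuotient O hK hχ) := by
  have he : ρ.asAlgebraHom (charIdem χ) = 1 := (charIdem_act hK hχ ρ hρ).1 hρχ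
  let f : charQuotient O hK hχ →ₐ[O] Module.End K (Fin n → K) :=
    { toFun := fun x => ρ.asAlgebraHom x.1.1
      map_one' := he
      map_mul' := fun x y => map_mul _ _ _
      map_zero' := map_zero _
      map_add' := fun x y => map_add _ _ _
      commutes' := fun r => by
        change ρ.asAlgebraHom (r • charIdem χ) = _
        rw [← algebraMap_smul K r (charIdem χ), map_smul, he, Algebra.algebraMap_eq_smul_one,
          Algebra.algebraMap_eq_smul_one, smul_assoc, one_smul] }
  have hinj : Function.Injective f := by
    rw [injective_iff_map_eq_zero]
    intro x hx
    apply Subtype.ext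
    apply Subtype.ext
    obtain ⟨-, h2⟩ := (Subsemigroup.mem_corner_iff (isIdempotentElem_charIdem hK hχ)).mp x.1.2
    exact h2.symm.trans (charIdem_mul_eq_zero ρ hK hχ hρ hρχ hx)
  have hrange : f.range = ρ.imageSubalgebra O := by
    ext y
    constructor
    · rintro ⟨x, rfl⟩
      obtain ⟨a, ha⟩ := x.2
      refine ⟨a, ?_⟩
      change MonoidAlgebra.lift O (Module.End K (Fin n → K)) G ρ a = ρ.asAlgebraHom x.1.1
      rw [ha, map_mul, he, mul_one, ρ.asAlgebraHom_mapRingHom]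
    · rintro ⟨a, rfl⟩
      have hid := isIdempotentElem_charIdem hK hχ
      refine ⟨⟨⟨MonoidAlgebra.mapRingHom G (algebraMap O K) a * charIdem χ, ?_⟩, a, rfl⟩, ?_⟩
      · refine (Subsemigroup.mem_corner_iff hid).mpr ⟨?_, ?_⟩
        · rw [← mul_assoc, (charIdem_commute hχ _).eq, mul_assoc, hid.eq]
        · rw [mul_assoc, hid.eq]
      · change ρ.asAlgebraHom (_ * charIdem χ) = _
        rw [map_mul, he, mul_one, ρ.asAlgebraHom_mapRingHom]
        rfl
  rw [← hrange] at h
  exact h.congr (AlgEquiv.ofInjective f hinj).symm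

end Image

/-! ### Solutions of `u ^ p ≡ 1` modulo a power of `p` -/

/-- Always `p ∣ u - 1`, so `p ^ n ∣ p * (u - 1)` suffices for the first alternative. Lifting the
exponent gives this for odd `p`; for `p = 2` it can fail when `u ≡ -1` modulo `4`. -/
theorem Int.prime_pow_dvd_sub_one_sq_or {p : ℕ} (hp : p.Prime) {n : ℕ} {u : ℤ}
    (h : (p : ℤ) ^ n ∣ u ^ p - 1) :
    (p : ℤ) ^ n ∣ (u - 1) ^ 2 ∨
      p = 2 ∧ 3 ≤ n ∧ (2 : ℤ) ∣ u - 1 ∧ (2 : ℤ) ^ n ∣ 2 * (u + 1) := by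
  obtain _ | m := n
  · simp
  have := Fact.mk hp
  have hpu : (p : ℤ) ∣ u - 1 := by
    have h1 : (p : ℤ) ∣ u ^ p - 1 := (dvd_pow_self _ m.succ_ne_zero).trans h
    rw [← ZMod.intCast_zmod_eq_zero_iff_dvd] at h1 ⊢
    simpa using h1
  have hmain : (p : ℤ) ^ (m + 1) ∣ p * (u - 1) → (p : ℤ) ^ (m + 1) ∣ (u - 1) ^ 2 := by
    intro h1
    rw [pow_two]
    exact h1.trans (mul_dvd_mul_right hpu _)
  rcases hp.eq_two_or_odd' with rfl | hodd
  · simp only [Nat.cast_ofNat] at h hpu hmain ⊢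
    obtain ⟨w, hw⟩ := hpu
    -- Exactly one of `u - 1`, `u + 1` is twice an odd number; the odd factor `1 + 2 * v` is
    -- cancelled.
    obtain ⟨v, rfl | rfl⟩ := w.even_or_odd'
    · left
      apply hmain
      have h2 : u ^ 2 - 1 = (2 * (u - 1)) * (1 + 2 * v) := by
        rw [eq_add_of_sub_eq hw]; ring
      rw [h2] at h
      refine IsCoprime.dvd_of_dvd_mul_right (IsCoprime.pow_left ?_) h
      exact ⟨-v, 1, by ring⟩
    · have h2 : u ^ 2 - 1 = (2 * (u + 1)) * (1 + 2 * v) := by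
        rw [eq_add_of_sub_eq hw]; ring
      rw [h2] at h
      have h3 : (2 : ℤ) ^ (m + 1) ∣ 2 * (u + 1) :=
        IsCoprime.dvd_of_dvd_mul_right (IsCoprime.pow_left ⟨-v, 1, by ring⟩) h
      by_cases hm : 3 ≤ m + 1
      · exact Or.inr ⟨trivial, hm, ⟨_, hw⟩, h3⟩
      · left
        refine (pow_dvd_pow 2 (by omega : m + 1 ≤ 2)).trans ?_
        rw [hw]
        exact ⟨(2 * v + 1) ^ 2, by ring⟩
  · left
    apply hmain
    rw [pow_succ']
    refine mul_dvd_mul_left _ ?_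
    have hx : ¬ (p : ℤ) ∣ u := by
      intro hu
      have h1 := dvd_sub hu hpu
      rw [sub_sub_cancel] at h1
      exact (Nat.prime_iff_prime_int.mp hp).not_dvd_one h1
    have h1 := Int.emultiplicity_pow_sub_pow hp hodd hpu hx p
    have h2 : emultiplicity p p = 1 := by
      have := (Nat.finiteMultiplicity_iff.mpr ⟨hp.ne_one, hp.pos⟩).emultiplicity_self
      simpa using this
    rw [one_pow, h2] at h1
    rw [pow_dvd_iff_le_emultiplicity, h1] at h
    rw [pow_dvd_iff_le_emultiplicity]
    push_cast at h
    exact (ENat.add_le_add_iff_right ENat.one_ne_top).mp h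

/-! ### Nested square roots dividing `2` -/

section DividesTwo

variable {O K : Type*} [CommRing O] [IsLocalRing O] [Field K] [Algebra O K]

variable (O) in
/-- `x` is a nonunit integral element, and `2 / x` is a nonunit integral element as well. -/
def StrictlyDividesTwo (x : K) : Prop :=
  ∃ α ∈ IsLocalRing.maximalIdeal O, ∃ c ∈ IsLocalRing.maximalIdeal O,
    α * c = 2 ∧ algebraMap O K α = x

/-- If `x = α` with `α c = 2`, then `y ^ 2 = α (1 + c δ)` is a unit multiple of `α`; if `x = 0`, it
is a unit multiple of `2`. Either way `y ^ 2` is a nonunit dividing `2`, so both `y` and `2 / y` are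
nonunits. -/
theorem StrictlyDividesTwo.of_sq_eq [IsDomain O] [IsIntegrallyClosed O] [IsFractionRing O K]
    (h2 : (2 : O) ∈ IsLocalRing.maximalIdeal O) {x y : K} {δ : O} (hδ : δ ^ 2 = 1)
    (hx : x = 0 ∨ StrictlyDividesTwo O x) (hy : y ^ 2 = x + 2 * algebraMap O K δ) :
    StrictlyDividesTwo O y := by
  obtain ⟨β, w, hβ, hβ2, hyβ⟩ : ∃ β w : O, β ∈ IsLocalRing.maximalIdeal O ∧ β * w = 2 ∧
      algebraMap O K β = y ^ 2 := by
    rcases hx with rfl | ⟨α, hα, c, hc, hαc, rfl⟩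
    · exact ⟨2 * δ, δ, Ideal.mul_mem_right _ _ h2, by linear_combination 2 * hδ,
        by rw [map_mul, hy, map_ofNat, zero_add]⟩
    · have hu : IsUnit (1 - c * -δ) :=
        IsLocalRing.isUnit_one_sub_self_of_mem_nonunits _
          ((IsLocalRing.mem_maximalIdeal _).mp (Ideal.mul_mem_right _ _ hc))
      obtain ⟨v, hv⟩ := hu.exists_right_inv
      refine ⟨α + 2 * δ, v * c, add_mem hα (Ideal.mul_mem_right _ _ h2), ?_,
        by rw [map_add, map_mul, hy, map_ofNat]⟩
      linear_combination α * c * hv + hαc - δ * v * c * hαc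
  obtain ⟨α, rfl⟩ := IsIntegrallyClosed.exists_algebraMap_eq_of_isIntegral_pow (R := O)
    (x := y) two_pos (hyβ ▸ isIntegral_algebraMap)
  have hαβ : β = α ^ 2 := IsFractionRing.injective O K (by rw [hyβ, map_pow])
  have hα : α ∈ IsLocalRing.maximalIdeal O :=
    Ideal.IsPrime.mem_of_pow_mem inferInstance 2 (hαβ ▸ hβ)
  exact ⟨α, hα, α * w, Ideal.mul_mem_right _ _ hα, by rw [← hβ2, hαβ]; ring, rfl⟩

/-- Squaring `Y` replaces `x` by `x ^ 2 - 2`, so induction descends to `Y ^ 2 = -1`, where `Y⁻¹ =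
-Y` and the scalar is `0`. -/
theorem StrictlyDividesTwo.of_add_inv [IsDomain O] [IsIntegrallyClosed O] [IsFractionRing O K]
    (h2 : (2 : O) ∈ IsLocalRing.maximalIdeal O) {E : Type*} [Ring E] [Nontrivial E] [Algebra K E]
    (k : ℕ) (Y Y' : E) (x : K) (h1 : Y * Y' = 1) (h1' : Y' * Y = 1) (hx : Y + Y' = x • (1 : E))
    (hk : Y ^ 2 ^ (k + 1) = -1) : x = 0 ∨ StrictlyDividesTwo O x := by
  induction k generalizing Y Y' x with
  | zero =>
    left
    have h3 : Y * Y = -1 := by rw [← hk, zero_add, pow_one, pow_two]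
    have h4 : Y' = -Y := by
      calc Y' = -((Y * Y) * Y') := by rw [h3]; simp
        _ = -Y := by rw [mul_assoc, h1, mul_one]
    rw [h4, add_neg_cancel, eq_comm, ← Algebra.algebraMap_eq_smul_one] at hx
    exact (map_eq_zero _).mp hx
  | succ k ih =>
    right
    have h5 : Y * Y + Y' * Y' = (x ^ 2 - 2) • (1 : E) := by
      have h6 : (Y + Y') * (Y + Y') = Y * Y + Y' * Y' + (2 : K) • (1 : E) := by
        rw [two_smul]
        nth_rewrite 1 [← h1]
        rw [← h1']
        noncomm_ring
      rw [sub_smul, ← sub_eq_of_eq_add h6, hx, smul_mul_smul_comm, mul_one, pow_two]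
    refine .of_sq_eq h2 (one_pow 2) (ih (Y * Y) (Y' * Y') _ ?_ ?_ h5 ?_) (by simp)
    · rw [mul_assoc, ← mul_assoc Y Y', h1, one_mul, h1]
    · rw [mul_assoc, ← mul_assoc Y' Y, h1', one_mul, h1']
    · rw [← hk, ← pow_two, ← pow_mul, ← pow_succ']

end DividesTwo

/-! ### The case `T X T⁻¹ = ± X⁻¹` -/

/-- A subalgebra generated by units `X`, `T` with `T X T⁻¹ = ± X⁻¹` and `X ^ 2 ^ (k + 2) = -1`,
the commutant of `X`, `T` being `K`, is symmetric. -/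
theorem Subalgebra.isSymmetricAlg_of_conj_eq_inv {O K E : Type*} [CommRing O] [IsDomain O]
    [IsLocalRing O] [IsIntegrallyClosed O] [Field K] [CharZero K] [Algebra O K]
    [IsFractionRing O K] [Ring E] [Nontrivial E] [Algebra K E] [Algebra O E] [IsScalarTower O K E]
    (h2 : (2 : O) ∈ IsLocalRing.maximalIdeal O) (S : Subalgebra O E) (τ : E →ₗ[K] K)
    (hτ : ∀ x y, τ (x * y) = τ (y * x)) (hτ1 : τ 1 = 1) {X X' T T' : E} (hXS : X ∈ S)
    (hTS : T ∈ S) (hTS' : T' ∈ S) (hX1 : X * X' = 1) (hX2 : X' * X = 1) (hT1 : T * T' = 1)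
    (hT2 : T' * T = 1) {ε : O} (hε : ε * ε = 1) (hTX : T * X = ε • (X' * T)) (k : ℕ)
    (hXk : X ^ 2 ^ (k + 2) = -1)
    (hsc : ∀ y : E, Commute y X → Commute y T → ∃ a : K, y = a • (1 : E))
    (hspan : ∀ x ∈ S, x ∈ Submodule.span O {y | ∃ j : ℕ, y = X ^ j ∨ y = T * X ^ j}) :
    IsSymmetricAlg O S := by
  have hτO : ∀ (r : O) (x : E), τ (r • x) = algebraMap O K r * τ x := by
    intro r x
    rw [← algebraMap_smul K r x, map_smul, smul_eq_mul]
  have hXX' : Commute X X' := hX1.trans hX2.symm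
  have hTX' : T * X' = ε • (X * T) := by
    calc T * X' = ε • ε • (X * (X' * T) * X') := by
          rw [smul_smul, hε, one_smul, ← mul_assoc, hX1, one_mul]
      _ = ε • (X * (T * X) * X') := by rw [hTX, mul_smul_comm, smul_mul_assoc]
      _ = ε • (X * T) := by rw [← mul_assoc, mul_assoc, hX1, mul_one]
  -- `X` is a root of a quadratic polynomial over `O`
  obtain ⟨a, ha⟩ := hsc (X + ε • X') ((Commute.refl X).add_left (hXX'.symm.smul_left ε)) <| by
    rw [commute_iff_eq, mul_add, add_mul, hTX, mul_smul_comm, hTX', smul_smul, hε, one_smul,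
      add_comm, smul_mul_assoc]
  have hsq : X * X + X' * X' = (a ^ 2 - 2 * algebraMap O K ε) • (1 : E) := by
    have h3 : (X + ε • X') * (X + ε • X') = X * X + X' * X' + (2 * algebraMap O K ε) • (1 : E) := by
      have h4 : (2 * algebraMap O K ε) • (1 : E) = ε • 1 + ε • 1 := by
        rw [mul_smul, two_smul, algebraMap_smul]
      rw [h4]
      simp only [add_mul, mul_add, smul_mul_assoc, mul_smul_comm, smul_add, smul_smul, hε, hX1,
        hX2, one_smul]
      abel
    rw [sub_smul, ← sub_eq_of_eq_add h3, ha, smul_mul_smul_comm, mul_one, pow_two]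
  obtain ⟨α, hα, c, hc, hαc, rfl⟩ : StrictlyDividesTwo O a := by
    refine .of_sq_eq h2 (by rw [pow_two, hε]) (StrictlyDividesTwo.of_add_inv h2 k (X * X) (X' * X') _ ?_ ?_ hsq ?_)
      (sub_add_cancel _ _).symm
    · rw [mul_assoc, ← mul_assoc X X', hX1, one_mul, hX1]
    · rw [mul_assoc, ← mul_assoc X' X, hX2, one_mul, hX2]
    · rw [← hXk, ← pow_two, ← pow_mul, ← pow_succ']
  rw [algebraMap_smul] at ha
  have hquad : X * X = α • X - ε • 1 := by
    calc X * X = (X + ε • X') * X - ε • (X' * X) := by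
          rw [add_mul, smul_mul_assoc, add_sub_cancel_right]
      _ = α • X - ε • 1 := by rw [ha, hX2, smul_one_mul]
  -- `I = X ^ 2 ^ (k + 1)` anticommutes with `T`
  obtain ⟨I, hI, hIX, hTI⟩ : ∃ I : E, I * I = -1 ∧ Commute X I ∧ T * I = -(I * T) := by
    refine ⟨X ^ 2 ^ (k + 1), ?_, (Commute.refl X).pow_right _, ?_⟩
    · rw [← pow_two, ← pow_mul, ← pow_succ, hXk]
    · have h5 : ∀ j, T * X ^ j = ε ^ j • (X' ^ j * T) := by
        intro j
        induction j with
        | zero => simp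
        | succ j ih =>
          rw [pow_succ, ← mul_assoc, ih, smul_mul_assoc, mul_assoc, hTX, mul_smul_comm, smul_smul,
            ← mul_assoc, ← pow_succ, ← pow_succ]
      have h6 : X' ^ 2 ^ (k + 1) = -X ^ 2 ^ (k + 1) := by
        have h7 : X' ^ 2 ^ (k + 1) * X ^ 2 ^ (k + 1) = 1 := by
          rw [← hXX'.symm.mul_pow, hX2, one_pow]
        calc X' ^ 2 ^ (k + 1) = -(X' ^ 2 ^ (k + 1) * X ^ 2 ^ (k + 2)) := by simp [hXk]
          _ = -X ^ 2 ^ (k + 1) := by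
            rw [pow_succ 2 (k + 1), mul_two, pow_add X, ← mul_assoc, h7, one_mul]
      rw [h5, h6, pow_succ', pow_mul, pow_two ε, hε, one_pow, one_smul, neg_mul]
  have hT'I : T' * I = -(I * T') := by
    calc T' * I = T' * (I * T) * T' := by rw [mul_assoc, mul_assoc, hT1, mul_one]
      _ = -(T' * (T * I) * T') := by rw [hTI]; simp
      _ = -(I * T') := by rw [← mul_assoc, hT2, one_mul]
  -- Conjugation by `I` preserves `τ` but negates `U * y`.
  have hanti : ∀ U y : E, U * I = -(I * U) → Commute y I → τ (U * y) = 0 := by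
    intro U y hU hy
    have h8 : τ (U * y) = -τ (U * y) := by
      calc τ (U * y) = -τ (U * y * I * I) := by rw [mul_assoc _ I, hI]; simp
        _ = -τ (I * (U * I * y)) := by rw [hτ, mul_assoc U, hy.eq, ← mul_assoc U]
        _ = -τ (U * y) := by rw [hU, neg_mul, mul_neg, ← mul_assoc, ← mul_assoc, hI]; simp
    exact self_eq_neg.mp h8
  -- Conjugation by `T` gives `X` and `ε • X'` the same trace, and they sum to `α`.
  have hτX : 2 * τ X = algebraMap O K α := by
    have h9 : τ X = algebraMap O K ε * τ X' := by
      calc τ X = τ (T' * (T * X)) := by rw [← mul_assoc, hT2, one_mul]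
        _ = algebraMap O K ε * τ X' := by
          rw [hTX, mul_smul_comm, hτO, hτ, mul_assoc, hT1, mul_one]
    have h10 := congrArg τ ha
    rw [map_add, hτO, hτO, hτ1, ← h9] at h10
    linear_combination h10
  -- the form and the dual families
  let f : E →ₗ[K] K := algebraMap O K c • τ
  have hf : ∀ x, f x = algebraMap O K c * τ x := fun x => rfl
  have hfO : ∀ (r : O) (x : E), f (r • x) = algebraMap O K r * f x := by
    intro r x
    rw [hf, hf, hτO, mul_left_comm]
  have hf1 : f 1 = algebraMap O K c := by rw [hf, hτ1, mul_one]
  have hfX : f X = 1 := by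
    have h11 : algebraMap O K α * algebraMap O K c = 2 := by rw [← map_mul, hαc, map_ofNat]
    rw [hf]
    refine mul_left_cancel₀ (two_ne_zero (α := K)) ?_
    linear_combination algebraMap O K c * hτX + h11
  have hfXX : f (X * X) = algebraMap O K (α - ε * c) := by
    rw [hquad, map_sub, hfO, hfO, hf1, hfX, map_sub, map_mul, mul_one]
  -- The Gram matrix of `f` on `1, X` has rows `(c, 1)` and `(1, α - ε c)`. Its determinant is a
  -- unit because `c` is a nonunit; `D` below comes from the inverse matrix.
  obtain ⟨d, hd⟩ : ∃ d, ((α - ε * c) * c - 1) * d = 1 := by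
    have hu : IsUnit (1 - c * (α - ε * c)) :=
      IsLocalRing.isUnit_one_sub_self_of_mem_nonunits _
        ((IsLocalRing.mem_maximalIdeal _).mp (Ideal.mul_mem_right _ _ hc))
    obtain ⟨v, hv⟩ := hu.exists_right_inv
    exact ⟨-v, by linear_combination hv⟩
  have hdK := congrArg (algebraMap O K) hd
  simp only [map_sub, map_mul, map_one] at hdK hfXX
  let D : Fin 2 → E := ![d • ((α - ε * c) • 1 - X), d • (c • X - 1)]
  have hDS : ∀ j, D j ∈ S := by
    intro j
    fin_cases j
    · exact S.smul_mem (sub_mem (S.smul_mem S.one_mem _) hXS) _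
    · exact S.smul_mem (sub_mem (S.smul_mem hXS _) S.one_mem) _
  have hDX : ∀ j, Commute (D j) X := by
    intro j
    fin_cases j
    · exact ((((Commute.one_left X).smul_left _).sub_left (Commute.refl X)).smul_left d)
    · exact ((((Commute.refl X).smul_left _).sub_left (Commute.one_left X)).smul_left d)
  have hDI : ∀ j, Commute (D j) I := by
    intro j
    fin_cases j
    · exact ((((Commute.one_left I).smul_left _).sub_left hIX).smul_left d)
    · exact (((hIX.smul_left _).sub_left (Commute.one_left I)).smul_left d)
  have hfD : ∀ i j : Fin 2, f (X ^ (i : ℕ) * D j) = if i = j then 1 else 0 := by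
    intro i j
    fin_cases i <;> fin_cases j <;>
      simp [D, hfO, hf1, hfX, hfXX, mul_sub, map_sub] <;> linear_combination hdK
  have hfD' : ∀ (U : E) (i j : Fin 2), U * I = -(I * U) → f (U * (X ^ (i : ℕ) * D j)) = 0 := by
    intro U i j hU
    rw [hf, hanti U _ hU ((hIX.pow_left _).mul_left (hDI j)), mul_zero]
  have hfc : ∀ x y, f (x * y) = f (y * x) := fun x y => by rw [hf, hf, hτ]
  let U : Fin 2 → E := ![1, T]
  let U' : Fin 2 → E := ![1, T']
  refine S.isSymmetricAlg_of_dual_families f hfc (ι := Fin 2 × Fin 2)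
    (fun i => U i.1 * X ^ (i.2 : ℕ)) (fun j => D j.2 * U' j.1) ?_ ?_ ?_ ?_ ?_
  · rintro ⟨l, i⟩
    refine mul_mem ?_ (pow_mem hXS _)
    fin_cases l
    exacts [S.one_mem, hTS]
  · rintro ⟨l, i⟩
    refine mul_mem (hDS _) ?_
    fin_cases l
    exacts [S.one_mem, hTS']
  · intro x hx
    refine Submodule.span_le.mpr ?_ (hspan x hx)
    have h12 : ∀ j : ℕ, X ^ j ∈ Submodule.span O ({1, X} : Set E) := by
      intro j
      induction j with
      | zero =>
        rw [pow_zero]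
        exact Submodule.subset_span (by simp)
      | succ j ih =>
        obtain ⟨r, s, hrs⟩ := Submodule.mem_span_pair.mp ih
        refine Submodule.mem_span_pair.mpr ⟨-(s * ε), r + s * α, ?_⟩
        rw [pow_succ, ← hrs, add_mul, smul_mul_assoc, smul_mul_assoc, hquad, one_mul]
        module
    have h13 : ∀ (l : Fin 2) (j : ℕ), U l * X ^ j ∈
        Submodule.span O (Set.range fun i : Fin 2 × Fin 2 => U i.1 * X ^ (i.2 : ℕ)) := by
      intro l j
      obtain ⟨r, s, hrs⟩ := Submodule.mem_span_pair.mp (h12 j)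
      rw [← hrs, mul_add, mul_smul_comm, mul_smul_comm]
      refine add_mem (Submodule.smul_mem _ _ (Submodule.subset_span ⟨(l, 0), ?_⟩))
        (Submodule.smul_mem _ _ (Submodule.subset_span ⟨(l, 1), ?_⟩)) <;> simp
    rintro _ ⟨j, rfl | rfl⟩
    · simpa [U] using h13 0 j
    · simpa [U] using h13 1 j
  · rintro ⟨l, i⟩
    fin_cases l
    · fin_cases i
      · exact ⟨c, by simp [U, hf1]⟩
      · exact ⟨1, by simp [U, hfX]⟩
    · refine ⟨0, ?_⟩
      simp only [U, map_zero]
      rw [hf]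
      exact (mul_eq_zero_of_right _ (hanti T _ hTI (hIX.pow_left _))).symm
  · rintro ⟨l, i⟩ ⟨l', j⟩
    fin_cases l <;> fin_cases l'
    · simpa [U, U'] using hfD i j
    · have h14 : f (X ^ (i : ℕ) * D j * T') = 0 := by
        rw [hfc]
        exact hfD' T' i j hT'I
      simpa [U, U', mul_assoc] using h14
    · simpa [U, U', mul_assoc] using hfD' T i j hTI
    · have h14 : f (T * (X ^ (i : ℕ) * D j * T')) = f (X ^ (i : ℕ) * D j) := by
        rw [hfc, mul_assoc, hT2, mul_one]
      rw [hfD] at h14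
      simpa [U, U', mul_assoc] using h14

/-! ### Normalized trace and the case of scalar commutators -/

section NormalizedTrace
variable {K : Type*} [Field K] {n : ℕ}

/-- The trace on `n × n` matrices, divided by `n`. -/
noncomputable def normTrace (K : Type*) [Field K] (n : ℕ) : Module.End K (Fin n → K) →ₗ[K] K :=
  (n : K)⁻¹ • LinearMap.trace K (Fin n → K)

theorem normTrace_mul_comm (x y : Module.End K (Fin n → K)) :
    normTrace K n (x * y) = normTrace K n (y * x) := by
  simp only [normTrace, LinearMap.smul_apply, LinearMap.trace_mul_comm K x y]

theorem normTrace_one [CharZero K] (hn : n ≠ 0) : normTrace K n 1 = 1 := by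
  simp [normTrace, hn]

end NormalizedTrace

/-- The elements of the domain of `f` whose image commutes with `y`. -/
def MonoidHom.commuteSubgroup {G M : Type*} [Group G] [Monoid M] (f : G →* M) (y : M) :
    Subgroup G where
  carrier := {g | Commute y (f g)}
  one_mem' := by simp
  mul_mem' := fun {a b} (ha : Commute y (f a)) (hb : Commute y (f b)) => by
    change Commute y (f (a * b))
    rw [map_mul]
    exact ha.mul_right hb
  inv_mem' := fun {g} (hg : Commute y (f.toHomUnits g)) => by
    change Commute y (f.toHomUnits g⁻¹ : Mˣ)
    rw [map_inv]
    exact hg.units_inv_right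

theorem MonoidHom.commute_of_generators {G M : Type*} [Group G] [Monoid M] (f : G →* M) {y : M}
    {h t : G} (hgen : Subgroup.zpowers h ⊔ Subgroup.zpowers t = ⊤) (hh : Commute y (f h))
    (ht : Commute y (f t)) (g : G) : Commute y (f g) := by
  have h1 : Subgroup.zpowers h ⊔ Subgroup.zpowers t ≤ f.commuteSubgroup y := by
    rw [sup_le_iff, Subgroup.zpowers_le, Subgroup.zpowers_le]
    exact ⟨hh, ht⟩
  rw [hgen] at h1
  exact h1 (Subgroup.mem_top g)

/-- The elements which commute with the whole group in a representation. -/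
def Representation.scalarSubgroup {K G V : Type*} [Field K] [Group G] [AddCommGroup V] [Module K V]
    (ρ : Representation K G V) : Subgroup G :=
  ⨅ x, MonoidHom.commuteSubgroup ρ (ρ x)

theorem Representation.mem_scalarSubgroup {K G V : Type*} [Field K] [Group G] [AddCommGroup V]
    [Module K V] {ρ : Representation K G V} {g : G} :
    g ∈ ρ.scalarSubgroup ↔ ∀ x, Commute (ρ g) (ρ x) := by
  rw [scalarSubgroup, Subgroup.mem_iInf]
  exact forall_congr' fun x => Commute.symm_iff

instance Representation.normal_scalarSubgroup {K G V : Type*} [Field K] [Group G]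
    [AddCommGroup V] [Module K V] (ρ : Representation K G V) : ρ.scalarSubgroup.Normal where
  conj_mem g hg x := by
    rw [mem_scalarSubgroup] at hg ⊢
    have h1 : ρ (x * g * x⁻¹) = ρ g := by
      rw [map_mul, map_mul, ← (hg x).eq, mul_assoc, ← map_mul, mul_inv_cancel, map_one, mul_one]
    rwa [h1]

section ClassTwo
variable {O K G : Type*} [CommRing O] [IsIntegrallyClosed O] [Field K] [CharZero K]
  [Algebra O K] [IsFractionRing O K] [Group G] [Fintype G] {n : ℕ}
  {ρ : Representation K G (Fin n → K)}

/-- If all commutators act as scalars, the image of the group ring is a twisted group algebra. -/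
theorem Representation.isSymmetricAlg_image_of_commutator (hK : IsSplittingFieldFor K G)
    (hρ : ρ.IsIrreducible) (hc : ∀ x y : G, x * y * x⁻¹ * y⁻¹ ∈ ρ.scalarSubgroup) :
    IsSymmetricAlg O (ρ.imageSubalgebra O) := by
  classical
  have : NeZero n := ⟨hρ.dim_ne_zero⟩
  set Z := ρ.scalarSubgroup
  have hZ : ∀ g ∈ Z, ∃ r : O, ρ g = r • 1 := by
    intro g hg
    obtain ⟨k, hk⟩ := ρ.exists_eq_smul_one_of_commute hK hρ
      (Representation.mem_scalarSubgroup.mp hg)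
    -- The scalar is a root of unity, hence integral over `O`.
    have h1 : k ^ Nat.card G = 1 := by
      have h2 : (k ^ Nat.card G) • (1 : Module.End K (Fin n → K)) = 1 := by
        rw [← one_pow (Nat.card G), ← smul_pow, ← hk, ← map_pow, pow_card_eq_one', map_one, one_pow]
      rw [← Algebra.algebraMap_eq_smul_one] at h2
      exact (algebraMap K (Module.End K (Fin n → K))).injective (h2.trans (map_one _).symm)
    obtain ⟨r, rfl⟩ := IsIntegrallyClosed.exists_algebraMap_eq_of_isIntegral_pow (R := O)
      (x := k) (Nat.card_pos (α := G)) (h1 ▸ isIntegral_one)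
    exact ⟨r, by rw [hk, algebraMap_smul]⟩
  have hnZ : ∀ g, g ∉ Z → normTrace K n (ρ g) = 0 := by
    intro g hg
    obtain ⟨x, hx⟩ := not_forall.mp (mt Representation.mem_scalarSubgroup.mpr hg)
    obtain ⟨k, hk⟩ := ρ.exists_eq_smul_one_of_commute hK hρ
      (Representation.mem_scalarSubgroup.mp (hc x g))
    have h1 : ρ (x * g * x⁻¹) = k • ρ g := by
      rw [← smul_one_mul, ← hk, ← map_mul, inv_mul_cancel_right]
    -- Conjugation by `x` multiplies `ρ g` by `k` and preserves its trace; `k = 1` would make `g`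
    -- and `x` commute under `ρ`.
    have h2 : normTrace K n (ρ g) = k * normTrace K n (ρ g) := by
      rw [← smul_eq_mul, ← map_smul, ← h1, map_mul ρ, normTrace_mul_comm, ← map_mul ρ, ← mul_assoc,
        inv_mul_cancel, one_mul]
    by_contra h0
    have hk1 : k = 1 := mul_right_cancel₀ h0 (h2.symm.trans (one_mul _).symm)
    rw [hk1, one_smul] at h1
    apply hx
    calc ρ g * ρ x = ρ (x * g * x⁻¹) * ρ x := by rw [h1]
      _ = ρ x * ρ g := by rw [← map_mul, ← map_mul, inv_mul_cancel_right]
  refine (ρ.imageSubalgebra O).isSymmetricAlg_of_dual_families (normTrace K n) normTrace_mul_comm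
    (ι := G ⧸ Z) (fun q => ρ q.out) (fun q => ρ q.out⁻¹)
    (fun q => ρ.apply_mem_imageSubalgebra _) (fun q => ρ.apply_mem_imageSubalgebra _)
    (fun x hx => ρ.mem_span_of_mem_imageSubalgebra hx fun g => ?_) (fun q => ?_) (fun q r => ?_)
  · obtain ⟨r, hr⟩ := hZ ((g : G ⧸ Z).out⁻¹ * g) (QuotientGroup.eq.mp (Quotient.out_eq' _))
    have h1 : ρ g = r • ρ (g : G ⧸ Z).out := by
      rw [← mul_smul_one, ← hr, ← map_mul, mul_inv_cancel_left]
    rw [h1]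
    exact Submodule.smul_mem _ _ (Submodule.subset_span ⟨_, rfl⟩)
  · by_cases h : q.out ∈ Z
    · obtain ⟨r, hr⟩ := hZ _ h
      refine ⟨r, ?_⟩
      rw [hr, ← algebraMap_smul K r, map_smul, normTrace_one hρ.dim_ne_zero, smul_eq_mul, mul_one]
    · exact ⟨0, by rw [hnZ _ h, map_zero]⟩
  · split_ifs with h
    · rw [h, ← map_mul, mul_inv_cancel, map_one, normTrace_one hρ.dim_ne_zero]
    · rw [normTrace_mul_comm, ← map_mul]
      refine hnZ _ fun hqr => h ?_
      rw [← Quotient.out_eq' q, ← Quotient.out_eq' r]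
      exact (QuotientGroup.eq.mpr hqr).symm

end ClassTwo

/-! ### Generators and the final case distinction -/

/-- A subgroup of prime index together with an element outside of it generates the group. -/
theorem Subgroup.sup_zpowers_eq_top_of_index_prime {G : Type*} [Group G] {H : Subgroup G}
    (hH : H.index.Prime) {t : G} (ht : t ∉ H) : H ⊔ Subgroup.zpowers t = ⊤ := by
  have h1 : H.relIndex (H ⊔ zpowers t) * (H ⊔ zpowers t).index = H.index :=
    relIndex_mul_index le_sup_left
  rcases (Nat.dvd_prime hH).mp (Dvd.intro_left _ h1) with h2 | h2
  · exact index_eq_one.mp h2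
  · rw [h2] at h1
    have h3 := relIndex_eq_one.mp (Nat.eq_of_mul_eq_mul_right hH.pos (h1.trans (one_mul _).symm))
    exact absurd (h3 (le_sup_right (a := H) (mem_zpowers t))) ht

/-- If the commutator of two generators lies in a normal subgroup `N`, all commutators do. -/
theorem Subgroup.commutator_mem_of_generators {G : Type*} [Group G] {N : Subgroup G} [N.Normal]
    {h t : G} (hgen : zpowers h ⊔ zpowers t = ⊤) (hN : t * h * t⁻¹ * h⁻¹ ∈ N) (x y : G) :
    x * y * x⁻¹ * y⁻¹ ∈ N := by
  have key : ∀ a b : G, a * b * a⁻¹ * b⁻¹ ∈ N ↔ Commute (a : G ⧸ N) (b : G ⧸ N) := by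
    intro a b
    rw [← QuotientGroup.eq_one_iff, commute_iff_eq]
    simp only [QuotientGroup.mk_mul, QuotientGroup.mk_inv]
    rw [mul_inv_eq_one, mul_inv_eq_iff_eq_mul]
  rw [key] at hN ⊢
  have hle : ∀ c : G ⧸ N, Commute c (h : G ⧸ N) → Commute c (t : G ⧸ N) →
      ∀ z : G, Commute c (z : G ⧸ N) := fun c h1 h2 =>
    (QuotientGroup.mk' N).commute_of_generators hgen h1 h2
  exact hle _ (hle _ (.refl _) hN.symm x).symm (hle _ hN (.refl _) x).symm y

theorem proposition1p6 {p : ℕ} [Fact p.Prime]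
    {O : Type*} [CommRing O] [IsDomain O] [IsDiscreteValuationRing O]
    [IsAdicComplete (IsLocalRing.maximalIdeal O) O] [CharP (IsLocalRing.ResidueField O) p]
    {K : Type*} [Field K] [CharZero K] [Algebra O K] [IsFractionRing O K]
    {P : Type*} [Group P] [Fintype P] (hP : IsPGroup p P)
    (hH : ∃ H : Subgroup P, H.Normal ∧ IsCyclic H ∧ H.index = p)
    (hK : IsSplittingFieldFor K P) (χ : P → K) (hχ : χ ∈ IrrChar K P) :
    IsSymmetricAlg O (charQuotient O hK hχ) := by
  have hp : p.Prime := Fact.out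
  obtain ⟨n, ρ, hρ, hρχ⟩ := id hχ
  apply charQuotient_isSymmetricAlg_of_image ρ hK hχ hρ hρχ
  have : NeZero n := ⟨hρ.dim_ne_zero⟩
  obtain ⟨H, hn, hcyc, hidx⟩ := hH
  obtain ⟨h, rfl⟩ := (Subgroup.isCyclic_iff_exists_zpowers_eq_top H).mp hcyc
  obtain ⟨t, ht⟩ : ∃ t, t ∉ Subgroup.zpowers h := by
    by_contra! hall
    rw [(Subgroup.eq_top_iff' _).mpr hall, Subgroup.index_top] at hidx
    exact hp.ne_one hidx.symm
  have hgen := Subgroup.sup_zpowers_eq_top_of_index_prime (hidx ▸ hp) ht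
  obtain ⟨u, hu⟩ := Subgroup.mem_zpowers_iff.mp (hn.conj_mem h (Subgroup.mem_zpowers h) t)
  have hconj : ∀ w : ℤ, t * h ^ w * t⁻¹ = h ^ (u * w) := fun w => by
    rw [← conj_zpow, ← hu, zpow_mul]
  have hup : h ^ (u ^ p) = h := by
    have h1 : ∀ j : ℕ, t ^ j * h * (t ^ j)⁻¹ = h ^ (u ^ j) := by
      intro j
      induction j with
      | zero => simp
      | succ j ih =>
        rw [pow_succ' u, ← hconj, ← ih, pow_succ']
        group
    obtain ⟨j, hj⟩ := Subgroup.mem_zpowers_iff.mp ((Subgroup.zpowers h).pow_index_mem t)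
    rw [← h1, ← hidx, ← hj, mul_inv_eq_iff_eq_mul]
    exact ((Commute.refl h).zpow_left j).eq
  -- the order of `ρ h` is a power of `p`
  let φ : P →* (Module.End K (Fin n → K))ˣ := MonoidHom.toHomUnits ρ
  obtain ⟨m, hm⟩ : ∃ m, orderOf (φ h) = p ^ m := by
    obtain ⟨N, hN⟩ := (IsPGroup.iff_orderOf.mp hP) h
    obtain ⟨m, -, hm⟩ := (Nat.dvd_prime_pow hp).mp (hN ▸ orderOf_map_dvd φ h)
    exact ⟨m, hm⟩
  have hφ : ∀ w : ℤ, (p : ℤ) ^ m ∣ w ↔ φ (h ^ w) = 1 := fun w => by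
    rw [map_zpow, ← orderOf_dvd_iff_zpow_eq_one, hm, Nat.cast_pow]
  have hφρ : ∀ x y, φ x = φ y → ρ x = ρ y := fun x y hxy => congrArg Units.val hxy
  -- The commutator of `t` and `h ^ w` is `h ^ ((u - 1) * w)`.
  have hscal : ∀ w : ℤ, (p : ℤ) ^ m ∣ (u - 1) * w → h ^ w ∈ ρ.scalarSubgroup := by
    intro w hw
    refine Representation.mem_scalarSubgroup.mpr (MonoidHom.commute_of_generators ρ hgen ?_ ?_)
    · rw [commute_iff_eq, ← map_mul, ← map_mul, ((Commute.refl h).zpow_left w).eq]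
    · rw [commute_iff_eq, ← map_mul, ← map_mul]
      apply hφρ
      have h2 : t * h ^ w = h ^ ((u - 1) * w) * (h ^ w * t) := by
        rw [← mul_assoc, ← zpow_add, ← mul_inv_eq_iff_eq_mul, hconj]
        congr 1
        ring
      rw [h2, map_mul φ (h ^ ((u - 1) * w)), (hφ _).mp hw, one_mul]
  have hsign : ∀ w : ℤ, (p : ℤ) ^ m ∣ (u - 1) * w → (p : ℤ) ^ m ∣ 2 * w →
      ∃ ε : O, (ε = 1 ∨ ε = -1) ∧ ρ (h ^ w) = ε • 1 := by
    intro w hw hw2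
    obtain ⟨e, he⟩ := ρ.exists_eq_smul_one_of_commute hK hρ
      (Representation.mem_scalarSubgroup.mp (hscal w hw))
    have h3 : e * e = 1 := by
      have h4 : ρ (h ^ w) * ρ (h ^ w) = 1 := by
        rw [← map_mul, ← zpow_add, ← two_mul, hφρ _ 1 (((hφ _).mp hw2).trans (map_one _).symm),
          map_one]
      rw [he, smul_mul_smul_comm, mul_one, ← Algebra.algebraMap_eq_smul_one] at h4
      exact (algebraMap K (Module.End K (Fin n → K))).injective (h4.trans (map_one _).symm)
    rcases mul_self_eq_one_iff.mp h3 with rfl | rfl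
    · exact ⟨1, Or.inl rfl, by rw [he, one_smul, one_smul]⟩
    · exact ⟨-1, Or.inr rfl, by
        rw [he, ← algebraMap_smul K (-1 : O), map_neg, map_one]⟩
  have hdvd : (p : ℤ) ^ m ∣ u ^ p - 1 := by
    rw [hφ, zpow_sub, hup, zpow_one, mul_inv_cancel, map_one]
  rcases Int.prime_pow_dvd_sub_one_sq_or hp hdvd with hsq | ⟨rfl, hm3, ⟨v, hv⟩, hu2⟩
  · refine ρ.isSymmetricAlg_image_of_commutator hK hρ
      (Subgroup.commutator_mem_of_generators hgen ?_)
    rw [← hu, ← zpow_sub_one]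
    exact hscal _ (by rwa [← pow_two])
  · obtain ⟨k, rfl⟩ := Nat.exists_eq_add_of_le' hm3
    simp only [Nat.cast_ofNat] at *
    have h2 : (2 : O) ∈ IsLocalRing.maximalIdeal O := by
      rw [← IsLocalRing.residue_eq_zero_iff, map_ofNat]
      exact_mod_cast CharP.cast_eq_zero (IsLocalRing.ResidueField O) 2
    -- `t h t⁻¹ = h ^ (u + 1) * h⁻¹`, so the sign of `h ^ (u + 1)` is the required `ε`.
    obtain ⟨ε, hε, hρε⟩ := hsign (u + 1)
      (by rw [hv, mul_right_comm]; exact hu2.mul_right v) hu2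
    obtain ⟨δ, hδ, hρδ⟩ := hsign (2 ^ (k + 2)) (by rw [hv]; exact ⟨v, by ring⟩) ⟨1, by ring⟩
    -- With `m = k + 3`, the exponent `2 ^ (k + 2)` is half the order of `ρ h`, so the sign is not
    -- `1`.
    have hδ1 : δ = -1 := by
      refine hδ.resolve_left ?_
      rintro rfl
      have h5 : (2 : ℤ) ^ (k + 3) ∣ 2 ^ (k + 2) := by
        rw [hφ]
        exact Units.ext (hρδ.trans (one_smul _ _))
      have h6 := Int.le_of_dvd (by positivity) h5
      rw [pow_succ] at h6
      have : (0 : ℤ) < 2 ^ (k + 2) := by positivity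
      omega
    have hinv : ∀ x, ρ x * ρ x⁻¹ = 1 := fun x => by rw [← map_mul, mul_inv_cancel, map_one]
    have hinv' : ∀ x, ρ x⁻¹ * ρ x = 1 := fun x => by rw [← map_mul, inv_mul_cancel, map_one]
    refine (ρ.imageSubalgebra O).isSymmetricAlg_of_conj_eq_inv h2 (normTrace K n)
      normTrace_mul_comm (normTrace_one hρ.dim_ne_zero) (ρ.apply_mem_imageSubalgebra h)
      (ρ.apply_mem_imageSubalgebra t) (ρ.apply_mem_imageSubalgebra t⁻¹) (hinv h) (hinv' h)
      (hinv t) (hinv' t) (ε := ε) (by rcases hε with rfl | rfl <;> simp) ?_ k ?_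
      (fun y hyh hyt => ρ.exists_eq_smul_one_of_commute hK hρ
        (MonoidHom.commute_of_generators ρ hgen hyh hyt))
      (fun x hx => ρ.mem_span_of_mem_imageSubalgebra hx fun g => Submodule.subset_span ?_)
    · rw [← smul_one_mul, ← hρε, ← map_mul, ← map_mul, ← map_mul, ← mul_assoc, ← zpow_sub_one,
        add_sub_cancel_right, hu, inv_mul_cancel_right]
    · rw [← map_pow, ← zpow_natCast]
      push_cast
      rw [hρδ, hδ1]
      exact neg_one_smul O (1 : Module.End K (Fin n → K))
    · have hpow : ∀ x ∈ Subgroup.zpowers h, ∃ j : ℕ, h ^ j = x := fun x hx =>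
        Submonoid.mem_powers_iff _ _ |>.mp (mem_powers_iff_mem_zpowers.mpr hx)
      by_cases hg : g ∈ Subgroup.zpowers h
      · obtain ⟨j, rfl⟩ := hpow g hg
        exact ⟨j, Or.inl (map_pow _ _ _)⟩
      · obtain ⟨j, hj⟩ := hpow (t⁻¹ * g) <| by
          rw [Subgroup.mul_mem_iff_of_index_two hidx, inv_mem_iff]
          exact iff_of_false ht hg
        refine ⟨j, Or.inr ?_⟩
        rw [← map_pow, hj, ← map_mul, mul_inv_cancel_left]
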